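/- **Setting.** A directed graph $\Gamma=(V,D,s,t)$ consists of a set $V$ of vertices, a set $D$ of edges and source and target maps $s,t\colon D\to V$ (loops and multiple edges are allowed). It is locally finite if every vertex is the source of finitely many edges and the target of finitely many edges. Its fundamental group $\pi_1(\Gamma,v_0)$ is that of the associated graph, obtained by formally adding an inverse edge $\bar e$ (with $s(\bar e)=t(e)$, $t(\bar e)=s(e)$, $\bar{\bar e}=e$) to each $e\in D$: the group of loops $(e_1,\dots,e_n)$ based at $v_0$ in the associated graph under concatenation, modulo inserting and removing subpaths $(e,\bar e)$. A covering map $p\colon\widetilde\Gamma\to\Gamma$ is a morphism of directed graphs, surjective on vertices, that restricts for every vertex $\tilde v$ of $\widetilde\Gamma$ to bijections between the edges with source (respectively target) $\tilde v$ and the edges with source (respectively target) $p(\tilde v)$; it has finite degree if its fibres are finite. It is normal if $p_*(\pi_1(\widetilde\Gamma,\tilde v_0))$ is a normal subgroup of $\pi_1(\Gamma,p(\tilde v_0))$. Given complex edge-weights $x=(x_e)_{e\in D}$ on a locally finite $\Gamma$, the weighted adjacency operator $\mathsf A_\Gamma$ on $\mathbb C^V$ is $(\mathsf A_\Gamma f)(v)=\sum_{s(e)=v}x_e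 f(t(e))$. A connection with fibre a complex vector space $W$ is a family $\Phi=(\varphi_e)$ in $\mathrm{GL}(W)$, indexed by the edges of the associated graph, with $\varphi_{\bar e}=\varphi_e^{-1}$. It represents a representation $\tau\colon\pi_1(\Gamma,v_0)\to\mathrm{GL}(W)$ if $\tau([(e_1,\dots,e_n)])=\varphi_{e_1}\circ\dots\circ\varphi_{e_n}$ for all loops based at $v_0$. The twisted operator $\mathsf A_\Gamma^{\tau}$ on $W^V$ is $(\mathsf A_\Gamma^\tau f)(v)=\sum_{s(e)=v}x_e\,\varphi_e(f(t(e)))$, for any connection $\Phi$ representing $\tau$. **Statement.** Let $\Gamma$ be a locally finite directed graph with complex edge-weights $x$, let $p\colon\widetilde\Gamma\to\Gamma$ be a covering map of finite degree with $\widetilde\Gamma$ connected (it is enough that the associated graph of $\widetilde\Gamma$ is connected), fix a vertex $\tilde v_0$ of $\widetilde\Gamma$, put $v_0=p(\tilde v_0)$, and suppose that $p$ is normal. Let $G=\pi_1(\Gamma,v_0)/p_*(\pi_1(\widetilde\Gamma,\tilde v_0))$ be its Galois group, with canonical projection $\mathrm{pr}\colon\pi_1(\Gamma,v_0)\to G$,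 and endow $\widetilde\Gamma$ with the lifted weights $\tilde x_{\tilde e}=x_{p(\tilde e)}$. Let $\rho$ run over the irreducible finite-dimensional complex representations $\rho\colon G\to \mathrm{GL}(W_\rho)$, one from each isomorphism class. Then each $\rho\circ\mathrm{pr}$ is represented by a connection with fibre $W_\rho$, and for any choice of such connections the operator $\mathsf A_{\widetilde\Gamma}$ is conjugate, by a linear isomorphism $\mathbb C^{\widetilde V}\cong\bigoplus_\rho (W_\rho^{V})^{\oplus\deg(\rho)}$, to $$\bigoplus_{\rho\text{ irred.}}\bigl(\mathsf A_\Gamma^{\rho\circ\mathrm{pr}}\bigr)^{\oplus\deg(\rho)},$$ where $\deg(\rho)=\dim W_\rho$. -/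

import Mathlib

open scoped DirectSum

/-- A directed graph with vertex set `V` and edge set `D` (loops and multiple edges allowed). -/
structure MultiDigraph (V D : Type*) where
  src : D → V
  tgt : D → V

/-- A graph: a directed graph with a fixed-point-free involution `e ↦ inv e` on the edges that
reverses the direction of each edge. -/
structure SerreGraph (V D : Type*) extends MultiDigraph V D where
  inv : D → D
  inv_inv : ∀ e, inv (inv e) = e
  inv_ne : ∀ e, inv e ≠ e
  src_inv : ∀ e, src (inv e) = tgt e

namespace MultiDigraph

variable {V D V' D' : Type*}

/-- `Γ.IsPath v l w`: the list of edges `l` is a path in `Γ` with source `v` and target `w`.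
The empty list is the constant path at `v = w`. -/
def IsPath (Γ : MultiDigraph V D) : V → List D → V → Prop
  | v, [], w => v = w
  | v, e :: l, w => Γ.src e = v ∧ Γ.IsPath (Γ.tgt e) l w

theorem IsPath.append {Γ : MultiDigraph V D} {a b : List D} {u v w : V}
    (ha : Γ.IsPath u a v) (hb : Γ.IsPath v b w) : Γ.IsPath u (a ++ b) w := by
  induction a generalizing u with
  | nil => cases ha; exact hb
  | cons e a ih => exact ⟨ha.1, ih ha.2⟩

/-- Any two vertices are joined by a directed path. -/
def IsConnected (Γ : MultiDigraph V D) : Prop :=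
  ∀ v w, ∃ l, Γ.IsPath v l w

/-- The edges with source `v`. -/
def outEdges (Γ : MultiDigraph V D) (v : V) : Set D := {e | Γ.src e = v}

/-- The edges with target `v`. -/
def inEdges (Γ : MultiDigraph V D) (v : V) : Set D := {e | Γ.tgt e = v}

structure IsLocallyFinite (Γ : MultiDigraph V D) : Prop where
  out : ∀ v, (Γ.outEdges v).Finite
  into : ∀ v, (Γ.inEdges v).Finite

/-- The graph associated with a directed graph, obtained by formally adding an inverse
`Sum.inr e` to each edge `e` (which becomes `Sum.inl e`). -/
def assocGraph (Γ : MultiDigraph V D) : SerreGraph V (D ⊕ D) where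
  src := Sum.elim Γ.src Γ.tgt
  tgt := Sum.elim Γ.tgt Γ.src
  inv := Sum.swap
  inv_inv := Sum.swap_swap
  inv_ne := by rintro (e | e) <;> simp
  src_inv := by rintro (e | e) <;> rfl

theorem IsPath.assocGraph {Γ : MultiDigraph V D} {l : List D} {v w : V} (h : Γ.IsPath v l w) :
    Γ.assocGraph.IsPath v (l.map Sum.inl) w := by
  induction l generalizing v with
  | nil => exact h
  | cons e l ih => exact ⟨h.1, ih h.2⟩

/-- If any two vertices are joined by a directed path, then the associated graph is connected. -/
theorem IsConnected.assocGraph {Γ : MultiDigraph V D} (h : Γ.IsConnected) :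
    Γ.assocGraph.IsConnected := fun v w => by
  obtain ⟨l, hl⟩ := h v w
  exact ⟨_, hl.assocGraph⟩

/-- Morphisms of directed graphs. -/
structure Hom (Γ' : MultiDigraph V' D') (Γ : MultiDigraph V D) where
  onV : V' → V
  onE : D' → D
  src_onE : ∀ e, Γ.src (onE e) = onV (Γ'.src e)
  tgt_onE : ∀ e, Γ.tgt (onE e) = onV (Γ'.tgt e)

theorem Hom.isPath_map {Γ' : MultiDigraph V' D'} {Γ : MultiDigraph V D} (p : Hom Γ' Γ)
    {l : List D'} {v w : V'} (h : Γ'.IsPath v l w) :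
    Γ.IsPath (p.onV v) (l.map p.onE) (p.onV w) := by
  induction l generalizing v with
  | nil => exact congrArg p.onV h
  | cons e l ih =>
    refine ⟨by rw [p.src_onE, h.1], ?_⟩
    rw [p.tgt_onE]
    exact ih h.2

/-- Covering maps of directed graphs. -/
structure Hom.IsCovering {Γ' : MultiDigraph V' D'} {Γ : MultiDigraph V D} (p : Hom Γ' Γ) :
    Prop where
  surjective : Function.Surjective p.onV
  bijOn_out : ∀ v, Set.BijOn p.onE (Γ'.outEdges v) (Γ.outEdges (p.onV v))
  bijOn_in : ∀ v, Set.BijOn p.onE (Γ'.inEdges v) (Γ.inEdges (p.onV v))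

/-- A covering digraph of a locally finite digraph is locally finite. -/
theorem Hom.IsCovering.isLocallyFinite {Γ' : MultiDigraph V' D'} {Γ : MultiDigraph V D}
    {p : Hom Γ' Γ} (hp : p.IsCovering) (h : Γ.IsLocallyFinite) : Γ'.IsLocallyFinite where
  out v := by
    have := (hp.bijOn_out v).finite_iff_finite
    exact this.2 (h.out _)
  into v := by
    have := (hp.bijOn_in v).finite_iff_finite
    exact this.2 (h.into _)

/-- The fibres of `p` over the vertices are finite. (For a covering map, the fibre over an edge is
in bijection with the fibre over its source.) -/
def Hom.HasFiniteDegree {Γ' : MultiDigraph V' D'} {Γ : MultiDigraph V D} (p : Hom Γ' Γ) : Prop :=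
  ∀ v, (p.onV ⁻¹' {v}).Finite

end MultiDigraph

namespace SerreGraph

variable {V D V' D' : Type*}

theorem tgt_inv (Γ : SerreGraph V D) (e : D) : Γ.tgt (Γ.inv e) = Γ.src e := by
  rw [← Γ.src_inv, Γ.inv_inv]

/-- The loops of `Γ` based at `v`. -/
def Loop (Γ : SerreGraph V D) (v : V) : Type _ := {l : List D // Γ.IsPath v l v}

/-- Loops form a monoid under concatenation: `a * b` is `a` followed by `b`. -/
instance (Γ : SerreGraph V D) (v : V) : Monoid (Γ.Loop v) where
  one := ⟨[], rfl⟩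
  mul a b := ⟨a.1 ++ b.1, a.2.append b.2⟩
  one_mul _ := rfl
  mul_one a := Subtype.ext (List.append_nil a.1)
  mul_assoc a b c := Subtype.ext (List.append_assoc a.1 b.1 c.1)

/-- `b` is obtained from `a` by adding one loop `(e, inv e)` along the path. -/
def Step (Γ : SerreGraph V D) {v : V} (a b : Γ.Loop v) : Prop :=
  ∃ (l r : List D) (e : D), a.1 = l ++ r ∧ b.1 = l ++ [e, Γ.inv e] ++ r

/-- Homotopy of loops, as a congruence on the monoid of loops. -/
def homotopy (Γ : SerreGraph V D) (v : V) : Con (Γ.Loop v) where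
  r := Relation.EqvGen Γ.Step
  iseqv := Relation.EqvGen.is_equivalence _
  mul' := by
    intro a b c d hab hcd
    have h1 : Relation.EqvGen Γ.Step (a * c) (b * c) := by
      induction hab with
      | rel x y h =>
        obtain ⟨l, r, e, hx, hy⟩ := h
        exact .rel _ _ ⟨l, r ++ c.1, e,
          by change x.1 ++ c.1 = _; rw [hx]; simp, by change y.1 ++ c.1 = _; rw [hy]; simp⟩
      | refl x => exact .refl _
      | symm x y _ ih => exact .symm _ _ ih
      | trans x y z _ _ ih1 ih2 => exact .trans _ _ _ ih1 ih2
    have h2 : Relation.EqvGen Γ.Step (b * c) (b * d) := by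
      clear h1
      induction hcd with
      | rel x y h =>
        obtain ⟨l, r, e, hx, hy⟩ := h
        exact .rel _ _ ⟨b.1 ++ l, r, e,
          by change b.1 ++ x.1 = _; rw [hx]; simp, by change b.1 ++ y.1 = _; rw [hy]; simp⟩
      | refl x => exact .refl _
      | symm x y _ ih => exact .symm _ _ ih
      | trans x y z _ _ ih1 ih2 => exact .trans _ _ _ ih1 ih2
    exact .trans _ _ _ h1 h2

/-- The fundamental group: homotopy classes of loops based at `v`. -/
def FundGroup (Γ : SerreGraph V D) (v : V) : Type _ := (Γ.homotopy v).Quotient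

theorem isPath_reverse (Γ : SerreGraph V D) {l : List D} {v w : V}
    (h : Γ.IsPath v l w) : Γ.IsPath w (l.map Γ.inv).reverse v := by
  induction l generalizing v with
  | nil => exact Eq.symm h
  | cons e l ih =>
    have h1 : Γ.IsPath (Γ.tgt e) [Γ.inv e] v := ⟨Γ.src_inv e, (Γ.tgt_inv e).trans h.1⟩
    simpa using (ih h.2).append h1

/-- The inverse loop `(inv eₙ, …, inv e₁)` of `(e₁, …, eₙ)`. -/
def Loop.reverse {Γ : SerreGraph V D} {v : V} (a : Γ.Loop v) : Γ.Loop v :=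
  ⟨(a.1.map Γ.inv).reverse, Γ.isPath_reverse a.2⟩

theorem homotopy_reverse_append (Γ : SerreGraph V D) {v : V} :
    ∀ (l : List D) (w : V), Γ.IsPath w l v →
      ∀ h : Γ.IsPath v ((l.map Γ.inv).reverse ++ l) v,
        Γ.homotopy v ⟨(l.map Γ.inv).reverse ++ l, h⟩ 1
  | [], _, _, _ => Relation.EqvGen.refl _
  | e :: l, w, hl, h => by
    have h0 : Γ.IsPath v ((l.map Γ.inv).reverse ++ l) v := (Γ.isPath_reverse hl.2).append hl.2
    refine Relation.EqvGen.trans _ _ _ (Relation.EqvGen.symm _ _ (Relation.EqvGen.rel _ _ ?_))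
      (homotopy_reverse_append Γ l _ hl.2 h0)
    exact ⟨(l.map Γ.inv).reverse, l, Γ.inv e, rfl, by simp [Γ.inv_inv]⟩

theorem reverse_step (Γ : SerreGraph V D) {v : V} {a b : Γ.Loop v} (h : Γ.Step a b) :
    Γ.Step a.reverse b.reverse := by
  obtain ⟨l, r, e, ha, hb⟩ := h
  refine ⟨(r.map Γ.inv).reverse, (l.map Γ.inv).reverse, e, ?_, ?_⟩
  · simp [Loop.reverse, ha]
  · simp [Loop.reverse, hb, Γ.inv_inv]

theorem homotopy_reverse (Γ : SerreGraph V D) {v : V} {a b : Γ.Loop v}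
    (h : Γ.homotopy v a b) : Γ.homotopy v a.reverse b.reverse := by
  change Relation.EqvGen _ _ _
  change Relation.EqvGen _ _ _ at h
  induction h with
  | rel x y h => exact .rel _ _ (Γ.reverse_step h)
  | refl x => exact .refl _
  | symm x y _ ih => exact .symm _ _ ih
  | trans x y z _ _ ih1 ih2 => exact .trans _ _ _ ih1 ih2

instance (Γ : SerreGraph V D) (v : V) : Group (Γ.FundGroup v) where
  __ := (inferInstance : Monoid (Γ.homotopy v).Quotient)
  inv := Quotient.map' Loop.reverse fun _ _ h => Γ.homotopy_reverse h
  inv_mul_cancel := by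
    intro g
    induction g using Quotient.inductionOn' with
    | h a => exact Quotient.sound' (Γ.homotopy_reverse_append a.1 v a.2 _)

/-- The homotopy class of a loop. -/
def FundGroup.mk (Γ : SerreGraph V D) (v : V) : Γ.Loop v →* Γ.FundGroup v := (Γ.homotopy v).mk'

/-- A monoid homomorphism on loops that is invariant under elementary homotopies induces a
homomorphism on the fundamental group. -/
def FundGroup.lift {Γ : SerreGraph V D} {v : V} {M : Type*} [Monoid M] (f : Γ.Loop v →* M)
    (hf : ∀ a b, Γ.Step a b → f a = f b) : Γ.FundGroup v →* M :=
  (Γ.homotopy v).lift f fun a b h => by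
    change Relation.EqvGen _ _ _ at h
    change f a = f b
    induction h with
    | rel x y h => exact hf x y h
    | refl x => rfl
    | symm x y _ ih => exact ih.symm
    | trans x y z _ _ ih1 ih2 => exact ih1.trans ih2

/-- Morphisms of graphs. -/
structure Hom (Γ' : SerreGraph V' D') (Γ : SerreGraph V D) extends
    MultiDigraph.Hom Γ'.toMultiDigraph Γ.toMultiDigraph where
  onE_inv : ∀ e, onE (Γ'.inv e) = Γ.inv (onE e)

/-- The homomorphism `p_*` of fundamental groups induced by a morphism of graphs. -/
def Hom.mapFundGroup {Γ' : SerreGraph V' D'} {Γ : SerreGraph V D} (p : Hom Γ' Γ) (v : V') :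
    Γ'.FundGroup v →* Γ.FundGroup (p.onV v) :=
  FundGroup.lift
    ((FundGroup.mk Γ (p.onV v)).comp
      { toFun := fun a => ⟨a.1.map p.onE, p.isPath_map a.2⟩
        map_one' := rfl
        map_mul' := fun a b => Subtype.ext (List.map_append ..) })
    fun a b => by
      rintro ⟨l, r, e, ha, hb⟩
      refine Quotient.sound' (Relation.EqvGen.rel _ _ ⟨l.map p.onE, r.map p.onE, p.onE e, ?_, ?_⟩)
      · change a.1.map p.onE = _
        simp [ha]
      · change b.1.map p.onE = _
        simp [hb, p.onE_inv]

/-- A connection on the trivial vector bundle over `Γ` with fibre `W`: for each edge `e` an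
isomorphism `φ e` from the fibre over `tgt e` to the fibre over `src e`. -/
structure Connection (Γ : SerreGraph V D) (W : Type*) [AddCommGroup W] [Module ℂ W] where
  φ : D → (W ≃ₗ[ℂ] W)
  φ_inv : ∀ e, φ (Γ.inv e) = (φ e)⁻¹

/-- The representation `ρ^Φ` of the fundamental group given by the monodromy
`φ e₁ ∘ ⋯ ∘ φ eₙ` of loops `(e₁, …, eₙ)`. -/
def Connection.monodromy {Γ : SerreGraph V D} {W : Type*} [AddCommGroup W] [Module ℂ W]
    (Φ : Γ.Connection W) (v : V) : Representation ℂ (Γ.FundGroup v) W :=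
  (LinearEquiv.automorphismGroup.toLinearMapMonoidHom (R := ℂ) (M := W)).comp <|
    FundGroup.lift
      { toFun := fun a => (a.1.map Φ.φ).prod
        map_one' := rfl
        map_mul' := fun a b => (congrArg List.prod List.map_append).trans List.prod_append }
      fun a b => by
        rintro ⟨l, r, e, ha, hb⟩
        change (a.1.map Φ.φ).prod = (b.1.map Φ.φ).prod
        simp [ha, hb, Φ.φ_inv]

end SerreGraph

namespace MultiDigraph

variable {V D V' D' : Type*}

/-- The morphism of associated graphs induced by a morphism of digraphs. -/
def Hom.assocGraph {Γ' : MultiDigraph V' D'} {Γ : MultiDigraph V D} (p : Hom Γ' Γ) :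
    SerreGraph.Hom Γ'.assocGraph Γ.assocGraph where
  onV := p.onV
  onE := Sum.map p.onE p.onE
  src_onE := by rintro (e | e); exacts [p.src_onE e, p.tgt_onE e]
  tgt_onE := by rintro (e | e); exacts [p.tgt_onE e, p.src_onE e]
  onE_inv := by rintro (e | e) <;> rfl

/-- The fundamental group of a digraph, i.e. of its associated graph. -/
abbrev FundGroup (Γ : MultiDigraph V D) (v : V) : Type _ := Γ.assocGraph.FundGroup v

/-- The subgroup `p_* π₁(Γ', v)` of `π₁(Γ, p v)`. -/
def Hom.imageFundGroup {Γ' : MultiDigraph V' D'} {Γ : MultiDigraph V D} (p : Hom Γ' Γ) (v : V') :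
    Subgroup (Γ.FundGroup (p.onV v)) :=
  (p.assocGraph.mapFundGroup v).range

/-- The Galois group `π₁(Γ, p v) / p_* π₁(Γ', v)` of a normal covering; it is a group as soon as
`p_* π₁(Γ', v)` is a normal subgroup. -/
abbrev Hom.GaloisGroup {Γ' : MultiDigraph V' D'} {Γ : MultiDigraph V D} (p : Hom Γ' Γ) (v : V') :
    Type _ :=
  Γ.FundGroup (p.onV v) ⧸ p.imageFundGroup v

/-- The weighted adjacency operator `(A f)(v) = ∑_{src e = v} x e • f (tgt e)`. -/
noncomputable def adjOp (Γ : MultiDigraph V D) (hΓ : Γ.IsLocallyFinite) (x : D → ℂ) :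
    (V → ℂ) →ₗ[ℂ] (V → ℂ) where
  toFun f v := ∑ e ∈ (hΓ.out v).toFinset, x e * f (Γ.tgt e)
  map_add' f g := by ext v; simp [mul_add, Finset.sum_add_distrib]
  map_smul' c f := by ext v; simp [Finset.mul_sum, mul_left_comm]

/-- The twisted weighted adjacency operator
`(A f)(v) = ∑_{src e = v} x e • φ e (f (tgt e))` of a connection `Φ = (φ e)`. -/
noncomputable def twistedAdjOp (Γ : MultiDigraph V D) (hΓ : Γ.IsLocallyFinite) (x : D → ℂ)
    {W : Type*} [AddCommGroup W] [Module ℂ W] (Φ : Γ.assocGraph.Connection W) :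
    (V → W) →ₗ[ℂ] (V → W) where
  toFun f v := ∑ e ∈ (hΓ.out v).toFinset, x e • Φ.φ (Sum.inl e) (f (Γ.tgt e))
  map_add' f g := by ext v; simp [Finset.sum_add_distrib]
  map_smul' c f := by ext v; simp [Finset.smul_sum, smul_comm c]

end MultiDigraph

/-- `ρ i`, for `i : ι`, are the irreducible finite-dimensional complex representations of `G`, each
isomorphism class being listed exactly once. -/
structure IsIrrepList {G : Type*} [Group G] {ι : Type*} {W : ι → Type*}
    [∀ i, AddCommGroup (W i)] [∀ i, Module ℂ (W i)] (ρ : ∀ i, Representation ℂ G (W i)) : Prop where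
  finiteDimensional : ∀ i, FiniteDimensional ℂ (W i)
  irreducible : ∀ i, (ρ i).IsIrreducible
  injective : ∀ i j, Nonempty ((ρ i).Equiv (ρ j)) → i = j
  complete : ∀ (U : Type) [AddCommGroup U] [Module ℂ U] [FiniteDimensional ℂ U]
    (σ : Representation ℂ G U), σ.IsIrreducible → ∃ i, Nonempty (σ.Equiv (ρ i))

/-!
The vertices of a connected normal covering of a digraph `Γ` are the pairs `(v, g)` of a vertex `v`
of `Γ` and an element `g` of the Galois group `G`. To see this, choose a path in `Γ` from the base
point to each vertex (`SerreGraph.PathSystem`); these close up every path of `Γ` to a loop, whose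
homotopy class is `PathSystem.cls`. The `G`-component of a vertex `u` upstairs is the class of the
projection of any path from the base point to `u`. It does not depend on that path, since
`p_* π₁` is normal, and path lifting shows that the resulting map to `V × G` is a bijection
(`MultiDigraph.Hom.IsCovering.exists_vertexEquiv`). Crossing an edge over `e` multiplies the
`G`-component on the right by the class `h e` of `e`.

Hence `V' → ℂ` is `V → (G → ℂ)`, and the adjacency operator upstairs becomes the operator
`(A F)(v) = ∑_{src e = v} x e • R (h e) (F (tgt e))`, where `R` is right translation on `G → ℂ`. As
`G` is finite, `R` is the regular representation, which is the sum of the irreducible ones, each as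
often as its degree (`IsIrrepList.exists_regular_linearEquiv`). This follows from the semisimplicity
of the group algebra, the multiplicities being counted by Schur's lemma in
`exists_linearEquiv_pi_simple`.

It remains to replace `ρ (h e)` by the given connection `φ e`. Parallel transport along the chosen
paths is a gauge transformation that carries `φ e` to the monodromy of the class `h e`
(`PathSystem.holonomy_path_apply`). Conversely, `e ↦ ρ (h e)` is itself a connection with the
required monodromy (`PathSystem.exists_connection`).
-/

/-! ### The regular module of a semisimple algebra -/

section RegularModule

variable {k A : Type*} [Field k] [IsAlgClosed k] [Ring A] [Algebra k A]
  {ι : Type*} {M : ι → Type*} [∀ i, AddCommGroup (M i)] [∀ i, Module k (M i)]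
  [∀ i, Module A (M i)] [∀ i, IsScalarTower k A (M i)]

/-- Schur's lemma as a dimension count, for two members of a family of pairwise non-isomorphic
simple modules over an algebra over an algebraically closed field. -/
theorem finrank_linearMap_simple [DecidableEq ι] [∀ i, FiniteDimensional k (M i)]
    [∀ i, IsSimpleModule A (M i)] (hinj : ∀ i j, Nonempty (M i ≃ₗ[A] M j) → i = j) (i j : ι) :
    Module.finrank k (M j →ₗ[A] M i) = if j = i then 1 else 0 := by
  split_ifs with h
  · subst h
    have hb : Function.Bijective (algebraMap k (Module.End A (M j))) :=
      IsSimpleModule.algebraMap_end_bijective_of_isAlgClosed k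
    rw [← (LinearEquiv.ofBijective (Algebra.linearMap k (Module.End A (M j))) hb).finrank_eq,
      Module.finrank_self]
  · have : Subsingleton (M j →ₗ[A] M i) := subsingleton_of_forall_eq 0 fun f =>
      (LinearMap.bijective_or_eq_zero f).resolve_left fun hf =>
        h (hinj _ _ ⟨LinearEquiv.ofBijective f hf⟩)
    exact Module.finrank_zero_of_subsingleton

/-- The regular module of a semisimple algebra over an algebraically closed field contains each
simple module `M i` as many times as its dimension: by Schur's lemma the multiplicity is the
dimension of `Hom(A, M i) ≃ M i`. -/
theorem exists_linearEquiv_pi_simple [IsSemisimpleRing A] [∀ i, FiniteDimensional k (M i)]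
    [∀ i, IsSimpleModule A (M i)] (hinj : ∀ i j, Nonempty (M i ≃ₗ[A] M j) → i = j)
    (hcomplete : ∀ S : Submodule A A, IsSimpleModule A S → ∃ i, Nonempty (S ≃ₗ[A] M i)) :
    Finite ι ∧ Nonempty (A ≃ₗ[A] (∀ i, Fin (Module.finrank k (M i)) → M i)) := by
  classical
  obtain ⟨n, S, e, hS⟩ := IsSemisimpleModule.exists_linearEquiv_fin_dfinsupp A A
  choose c hc using fun j => hcomplete (S j) (hS j)
  let ePi : A ≃ₗ[A] ∀ j, M (c j) :=
    e.trans ((DirectSum.linearEquivFunOnFintype A (Fin n) fun j => S j).trans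
      (LinearEquiv.piCongrRight fun j => (hc j).some))
  -- The multiplicity of `M i`, computed from `M i ≃ Hom(A, M i) ≃ ∏ j, Hom(M (c j), M i)`.
  have hcard (i : ι) : Fintype.card {j // c j = i} = Module.finrank k (M i) := by
    have e1 : M i ≃ₗ[k] ∀ j, (M (c j) →ₗ[A] M i) :=
      (LinearMap.ringLmapEquivSelf A k (M i)).symm.trans
        ((LinearEquiv.congrLeft (M i) k ePi).trans
          (LinearMap.lsum A (fun j => M (c j)) k).symm)
    have hfin (i j : ι) : Module.Finite k (M j →ₗ[A] M i) :=
      .of_injective (LinearMap.restrictScalarsₗ k A (M j) (M i) k)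
        (LinearMap.restrictScalars_injective _)
    rw [e1.finrank_eq, Module.finrank_pi_fintype]
    simp_rw [finrank_linearMap_simple hinj]
    rw [Fintype.card_subtype, Finset.sum_boole, Nat.cast_id]
  let eFib (i : ι) : Fin (Module.finrank k (M i)) ≃ {j // c j = i} :=
    (Fintype.equivFinOfCardEq (hcard i)).symm
  -- Enumerating the copies of each `M i` identifies the index set of the decomposition.
  let σ : (Σ i, Fin (Module.finrank k (M i))) ≃ Fin n :=
    (Equiv.sigmaCongrRight eFib).trans (Equiv.sigmaFiberEquiv c)
  have hσ (a : Σ i, Fin (Module.finrank k (M i))) : c (σ a) = a.1 := (eFib a.1 a.2).2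
  refine ⟨?_, ⟨?_⟩⟩
  · refine Finite.of_surjective c fun i => ?_
    have := IsSimpleModule.nontrivial A (M i)
    exact ⟨_, (eFib i ⟨0, Module.finrank_pos⟩).2⟩
  · have eS (a : Σ i, Fin (Module.finrank k (M i))) : M (c (σ a)) ≃ₗ[A] M a.1 :=
      (hσ a) ▸ LinearEquiv.refl A (M (c (σ a)))
    exact ePi.trans ((LinearEquiv.piCongrLeft A (fun j => M (c j)) σ).symm.trans
      ((LinearEquiv.piCongrRight eS).trans (LinearEquiv.piCurry A fun i _ => M i)))

end RegularModule

/-! ### The regular representation of a finite group -/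

section RegularRepresentation

open Representation MonoidAlgebra

variable {k G V W : Type*} [Field k] [Group G]

/-- A linear isomorphism of modules over the group algebra is linear over the group algebra as
soon as it commutes with the group elements. -/
noncomputable def LinearEquiv.ofCommSingle [AddCommGroup V] [Module k V]
    [Module (MonoidAlgebra k G) V] [IsScalarTower k (MonoidAlgebra k G) V] [AddCommGroup W] [Module k W]
    [Module (MonoidAlgebra k G) W] [IsScalarTower k (MonoidAlgebra k G) W] (e : V ≃ₗ[k] W)
    (h : ∀ (g : G) (v : V), e (single g (1 : k) • v) = single g (1 : k) • e v) :
    V ≃ₗ[MonoidAlgebra k G] W :=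
  LinearEquiv.ofBijective (MonoidAlgebra.equivariantOfLinearOfComm e.toLinearMap h) e.bijective

/-- Equivalent representations are isomorphic as modules over the group algebra, and conversely. -/
theorem nonempty_asModule_linearEquiv_iff [AddCommGroup V] [Module k V] [AddCommGroup W]
    [Module k W] (ρ : Representation k G V) (σ : Representation k G W) :
    Nonempty (ρ.asModule ≃ₗ[MonoidAlgebra k G] σ.asModule) ↔ Nonempty (ρ.Equiv σ) := by
  constructor
  · rintro ⟨e⟩
    exact ⟨((IntertwiningMap.equivLinearMapAsModule ρ σ).symm e.toLinearMap).ofBijective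
      e.bijective⟩
  · rintro ⟨e⟩
    exact ⟨LinearEquiv.ofBijective
      (IntertwiningMap.equivLinearMapAsModule ρ σ e.toIntertwiningMap) e.toLinearEquiv.bijective⟩

/-- A simple submodule of the group algebra is afforded by one of the listed representations;
since the list is only tested against representations on types in `Type`, a copy of the submodule
on a coordinate space is used. -/
theorem IsIrrepList.exists_linearEquiv_of_isSimpleModule {G : Type*} [Group G] [Finite G]
    {ι : Type*} {W : ι → Type*} [∀ i, AddCommGroup (W i)] [∀ i, Module ℂ (W i)]
    {ρ : ∀ i, Representation ℂ G (W i)} (hρ : IsIrrepList ρ)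
    (S : Submodule (MonoidAlgebra ℂ G) (MonoidAlgebra ℂ G))
    (hS : IsSimpleModule (MonoidAlgebra ℂ G) S) :
    ∃ i, Nonempty (S ≃ₗ[MonoidAlgebra ℂ G] (ρ i).asModule) := by
  have : FiniteDimensional ℂ S :=
    inferInstanceAs (FiniteDimensional ℂ (S.restrictScalars ℂ))
  let b : S ≃ₗ[ℂ] (Fin (Module.finrank ℂ S) → ℂ) := (Module.finBasis ℂ S).equivFun
  let σ : Representation ℂ G (Fin (Module.finrank ℂ S) → ℂ) :=
    { toFun := fun g => b.conj (Algebra.lsmul ℂ ℂ S (single g (1 : ℂ)))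
      map_one' := by ext; simp [← one_def]
      map_mul' := fun g h => by
        have hgh : single (g * h) (1 : ℂ) = single g 1 * single h 1 := by simp
        rw [hgh, map_mul]
        ext; simp [LinearEquiv.conj_apply] }
  let eS : S ≃ₗ[MonoidAlgebra ℂ G] σ.asModule :=
    LinearEquiv.ofCommSingle (b.trans σ.asModuleEquiv.symm) fun g v => by
      have hσ : σ g (b v) = b (single g (1 : ℂ) • v) := by simp [σ, LinearEquiv.conj_apply]
      change σ.asModuleEquiv.symm (b _) = single g (1 : ℂ) • σ.asModuleEquiv.symm (b v)
      rw [← hσ, asModuleEquiv_symm_map_rho, of_apply]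
  have : IsSimpleModule (MonoidAlgebra ℂ G) σ.asModule := IsSimpleModule.congr eS.symm
  obtain ⟨i, hi⟩ := hρ.complete _ σ ((irreducible_iff_isSimpleModule_asModule σ).2 this)
  exact ⟨i, ⟨eS.trans ((nonempty_asModule_linearEquiv_iff _ _).2 hi).some⟩⟩

/-- The space of functions on a finite group, acted on by right translation, contains each
irreducible representation as many times as its degree. -/
theorem IsIrrepList.exists_regular_linearEquiv {G : Type*} [Group G] [Finite G]
    {ι : Type*} {W : ι → Type*} [∀ i, AddCommGroup (W i)] [∀ i, Module ℂ (W i)]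
    {ρ : ∀ i, Representation ℂ G (W i)} (hρ : IsIrrepList ρ) :
    Finite ι ∧ ∃ Θ : (G → ℂ) ≃ₗ[ℂ] (∀ i, Fin (Module.finrank ℂ (W i)) → W i),
      ∀ (h : G) (F : G → ℂ) i j, Θ (fun g => F (g * h)) i j = ρ i h (Θ F i j) := by
  have := hρ.finiteDimensional
  have (i : ι) : IsSimpleModule (MonoidAlgebra ℂ G) (ρ i).asModule :=
    (irreducible_iff_isSimpleModule_asModule _).1 (hρ.irreducible i)
  have : NeZero (Nat.card G : ℂ) := ⟨Nat.cast_ne_zero.2 Nat.card_pos.ne'⟩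
  obtain ⟨hι, ⟨e⟩⟩ := exists_linearEquiv_pi_simple (k := ℂ) (A := MonoidAlgebra ℂ G)
    (M := fun i => (ρ i).asModule)
    (fun i j hij => hρ.injective i j ((nonempty_asModule_linearEquiv_iff _ _).1 hij))
    hρ.exists_linearEquiv_of_isSimpleModule
  -- Inversion turns right translation into the left multiplication of the group algebra.
  let inv : (G → ℂ) ≃ₗ[ℂ] MonoidAlgebra ℂ G :=
    (LinearEquiv.funCongrLeft ℂ ℂ (Equiv.inv G)).trans
      ((Finsupp.linearEquivFunOnFinite ℂ ℂ G).symm.trans (coeffLinearEquiv ℂ).symm)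
  have hinv (h : G) (F : G → ℂ) : inv (fun g => F (g * h)) = single h (1 : ℂ) • inv F := by
    ext g
    rw [smul_eq_mul, coeff_single_mul_eq_mul_coeff (h⁻¹ * g)
      fun _ _ => eq_inv_mul_iff_mul_eq.symm, one_mul]
    change F (g⁻¹ * h) = F ((h⁻¹ * g)⁻¹)
    rw [mul_inv_rev, inv_inv]
  refine ⟨hι, inv.trans ((e.restrictScalars ℂ).trans (LinearEquiv.piCongrRight fun i =>
    LinearEquiv.piCongrRight fun _ => (ρ i).asModuleEquiv)), fun h F i j => ?_⟩
  have he := congrFun (congrFun (e.map_smul (single h (1 : ℂ)) (inv F)) i) j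
  change (ρ i).asModuleEquiv (e (inv fun g => F (g * h)) i j) = _
  rw [hinv, he]
  change (ρ i).asModuleEquiv (single h (1 : ℂ) • (e (inv F) i j : (ρ i).asModule)) = _
  rw [asModuleEquiv_map_smul, asAlgebraHom_single_one]
  rfl

end RegularRepresentation

/-! ### Paths up to homotopy -/

namespace MultiDigraph

variable {V D : Type*}

theorem isPath_append_iff {Γ : MultiDigraph V D} {a b : List D} {u w : V} :
    Γ.IsPath u (a ++ b) w ↔ ∃ v, Γ.IsPath u a v ∧ Γ.IsPath v b w := by
  refine ⟨fun h => ?_, fun ⟨v, ha, hb⟩ => ha.append hb⟩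
  induction a generalizing u with
  | nil => exact ⟨u, rfl, h⟩
  | cons e a ih =>
    obtain ⟨v, ha, hb⟩ := ih h.2
    exact ⟨v, ⟨h.1, ha⟩, hb⟩

theorem IsPath.target_unique {Γ : MultiDigraph V D} {l : List D} {u v w : V}
    (hv : Γ.IsPath u l v) (hw : Γ.IsPath u l w) : v = w := by
  induction l generalizing u with
  | nil => exact Eq.trans (Eq.symm hv) hw
  | cons e l ih => exact ih hv.2 hw.2

end MultiDigraph

namespace SerreGraph

variable {V D V' D' : Type*}

/-- The reversed path `(inv eₙ, …, inv e₁)` of `(e₁, …, eₙ)`. -/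
def rev (Γ : SerreGraph V D) (l : List D) : List D := (l.map Γ.inv).reverse

theorem rev_rev (Γ : SerreGraph V D) (l : List D) : Γ.rev (Γ.rev l) = l := by
  simp [rev, Function.comp_def, Γ.inv_inv]

/-- The class of a closed path, given as a list of edges. -/
def loopCls (Γ : SerreGraph V D) {v : V} (l : List D) (h : Γ.IsPath v l v) : Γ.FundGroup v :=
  FundGroup.mk Γ v ⟨l, h⟩

theorem loopCls_congr (Γ : SerreGraph V D) {v : V} {l l' : List D} (h : Γ.IsPath v l v)
    (h' : Γ.IsPath v l' v) (hl : l = l') : Γ.loopCls l h = Γ.loopCls l' h' := by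
  subst hl; rfl

/-- Removing a backtracking path from a loop does not change its class. -/
theorem loopCls_cancel (Γ : SerreGraph V D) {v : V} (l r q : List D)
    (h : Γ.IsPath v (l ++ (q ++ Γ.rev q) ++ r) v) (h' : Γ.IsPath v (l ++ r) v) :
    Γ.loopCls _ h = Γ.loopCls _ h' := by
  induction q generalizing l r with
  | nil => exact Γ.loopCls_congr _ _ (by simp [rev])
  | cons e q ih =>
    have hl : l ++ (e :: q ++ Γ.rev (e :: q)) ++ r =
        (l ++ [e]) ++ (q ++ Γ.rev q) ++ (Γ.inv e :: r) := by simp [rev]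
    have h2 : Γ.IsPath v ((l ++ [e]) ++ (Γ.inv e :: r)) v := by
      obtain ⟨u, hlu, hu⟩ := MultiDigraph.isPath_append_iff.1 h'
      obtain ⟨w, hw, -⟩ := MultiDigraph.isPath_append_iff.1 h
      obtain ⟨u', hw1, hw2⟩ := MultiDigraph.isPath_append_iff.1 hw
      obtain rfl := hw1.target_unique hlu
      have he : Γ.src e = u' := hw2.1
      have h1 : Γ.IsPath u' [e] (Γ.tgt e) := ⟨he, rfl⟩
      have h3 : Γ.IsPath (Γ.tgt e) (Γ.inv e :: r) v :=
        ⟨Γ.src_inv e, by rwa [Γ.tgt_inv, he]⟩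
      exact (hlu.append h1).append h3
    refine (Γ.loopCls_congr h (hl ▸ h) hl).trans ((ih _ _ _ h2).trans ?_)
    exact Quotient.sound' (Relation.EqvGen.symm _ _ (.rel _ _ ⟨l, r, e, rfl, by simp⟩))

/-- A choice of a path from a base point to each vertex, the constant path being chosen for the
base point itself. -/
structure PathSystem (Γ : SerreGraph V D) (v₀ : V) where
  path : V → List D
  isPath : ∀ v, Γ.IsPath v₀ (path v) v
  path_base : path v₀ = []

theorem nonempty_pathSystem {Γ : SerreGraph V D} {v₀ : V}
    (h : ∀ v, ∃ l, Γ.IsPath v₀ l v) : Nonempty (Γ.PathSystem v₀) := by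
  classical
  choose γ hγ using h
  refine ⟨⟨Function.update γ v₀ [], fun v => ?_, by simp⟩⟩
  by_cases hv : v = v₀
  · subst hv
    rw [Function.update_self]
    rfl
  · rw [Function.update_of_ne hv]
    exact hγ v

namespace PathSystem

variable {Γ : SerreGraph V D} {v₀ : V} (S : Γ.PathSystem v₀)

/-- The class of a path from `v` to `w`, closed up to a loop along the chosen paths from the base
point to `v` and to `w`. -/
def cls {v w : V} {l : List D} (h : Γ.IsPath v l w) : Γ.FundGroup v₀ :=
  Γ.loopCls (S.path v ++ l ++ Γ.rev (S.path w))
    (((S.isPath v).append h).append (Γ.isPath_reverse (S.isPath w)))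

theorem cls_congr {v w v₁ w₁ : V} {l l₁ : List D} (h : Γ.IsPath v l w) (h₁ : Γ.IsPath v₁ l₁ w₁)
    (hv : v = v₁) (hl : l = l₁) : S.cls h = S.cls h₁ := by
  subst hv hl
  obtain rfl := h.target_unique h₁
  rfl

theorem cls_append {u v w : V} {l m : List D} (hl : Γ.IsPath u l v) (hm : Γ.IsPath v m w) :
    S.cls (hl.append hm) = S.cls hl * S.cls hm := by
  have h := (((S.isPath u).append hl).append (Γ.isPath_reverse (S.isPath v))).append
    (((S.isPath v).append hm).append (Γ.isPath_reverse (S.isPath w)))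
  have h₀ := ((S.isPath u).append (hl.append hm)).append (Γ.isPath_reverse (S.isPath w))
  have e₁ : S.path u ++ l ++ Γ.rev (S.path v) ++ (S.path v ++ m ++ Γ.rev (S.path w)) =
      S.path u ++ l ++ (Γ.rev (S.path v) ++ Γ.rev (Γ.rev (S.path v))) ++
        (m ++ Γ.rev (S.path w)) := by simp [rev_rev]
  have e₂ : S.path u ++ (l ++ m) ++ Γ.rev (S.path w) =
      S.path u ++ l ++ (m ++ Γ.rev (S.path w)) := by simp
  have h₁ := h
  have h₂ := h₀
  change Γ.IsPath v₀ (S.path u ++ l ++ Γ.rev (S.path v) ++ (S.path v ++ m ++ Γ.rev (S.path w))) v₀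
    at h₁
  change Γ.IsPath v₀ (S.path u ++ (l ++ m) ++ Γ.rev (S.path w)) v₀ at h₂
  rw [e₁] at h₁
  rw [e₂] at h₂
  exact (Γ.loopCls_congr h₀ h₂ e₂).trans
    ((Γ.loopCls_cancel _ _ _ h₁ h₂).symm.trans (Γ.loopCls_congr h₁ h e₁.symm))

theorem cls_nil (v : V) : S.cls (show Γ.IsPath v [] v from rfl) = 1 := by
  have h := S.cls_append (show Γ.IsPath v [] v from rfl) (show Γ.IsPath v [] v from rfl)
  exact left_eq_mul.1 h

theorem cls_rev {v w : V} {l : List D} (h : Γ.IsPath v l w) :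
    S.cls (Γ.isPath_reverse h) = (S.cls h)⁻¹ := by
  refine eq_inv_of_mul_eq_one_right ?_
  rw [← cls_append, ← S.cls_nil v]
  have h₀ := (S.isPath v).append (Γ.isPath_reverse (S.isPath v))
  refine (Γ.loopCls_cancel (S.path v) (Γ.rev (S.path v)) l _ h₀).trans ?_
  exact Γ.loopCls_congr _ _ (by simp)

theorem cls_loop {l : List D} (h : Γ.IsPath v₀ l v₀) : S.cls h = Γ.loopCls l h :=
  Γ.loopCls_congr _ _ (by simp [S.path_base, rev])

/-- The class of an edge. -/
def edge (e : D) : Γ.FundGroup v₀ := S.cls (show Γ.IsPath (Γ.src e) [e] (Γ.tgt e) from ⟨rfl, rfl⟩)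

theorem edge_inv (e : D) : S.edge (Γ.inv e) = (S.edge e)⁻¹ := by
  rw [edge, edge, ← cls_rev]
  exact S.cls_congr _ _ (Γ.src_inv e) (by simp)

theorem cls_cons {v w : V} {e : D} {l : List D} (h : Γ.IsPath v (e :: l) w) :
    S.cls h = S.edge e * S.cls h.2 := by
  obtain ⟨rfl, h2⟩ := h
  exact S.cls_append (show Γ.IsPath (Γ.src e) [e] (Γ.tgt e) from ⟨rfl, rfl⟩) h2

end PathSystem

/-! ### Path lifting -/

namespace Hom

variable {Γ' : SerreGraph V' D'} {Γ : SerreGraph V D} (p : Hom Γ' Γ)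

/-- Every edge with source `p v` has exactly one lift with source `v`. -/
def HasUniqueLifts : Prop :=
  ∀ v, Set.BijOn p.onE (Γ'.outEdges v) (Γ.outEdges (p.onV v))

/-- Some path from `u` to `w` lies over `l`. -/
def Lifts (u : V') (l : List D) (w : V') : Prop := ∃ l', Γ'.IsPath u l' w ∧ l'.map p.onE = l

theorem map_rev (l : List D') : (Γ'.rev l).map p.onE = Γ.rev (l.map p.onE) := by
  simp [rev, Function.comp_def, p.onE_inv]

variable {p}

theorem lifts_append_iff {u w : V'} {a b : List D} :
    p.Lifts u (a ++ b) w ↔ ∃ v, p.Lifts u a v ∧ p.Lifts v b w := by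
  constructor
  · rintro ⟨l', h, hl⟩
    obtain ⟨a', b', rfl, ha, hb⟩ := List.map_eq_append_iff.1 hl
    obtain ⟨v, h1, h2⟩ := MultiDigraph.isPath_append_iff.1 h
    exact ⟨v, ⟨a', h1, ha⟩, ⟨b', h2, hb⟩⟩
  · rintro ⟨v, ⟨a', h1, rfl⟩, ⟨b', h2, rfl⟩⟩
    exact ⟨a' ++ b', h1.append h2, List.map_append⟩

theorem Lifts.rev {u w : V'} {l : List D} (h : p.Lifts u l w) : p.Lifts w (Γ.rev l) u := by
  obtain ⟨l', h, rfl⟩ := h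
  exact ⟨Γ'.rev l', Γ'.isPath_reverse h, p.map_rev l'⟩

namespace HasUniqueLifts

theorem exists_lift (hp : p.HasUniqueLifts) {u : V'} {w : V} {l : List D}
    (h : Γ.IsPath (p.onV u) l w) :
    ∃ w', p.onV w' = w ∧ p.Lifts u l w' := by
  induction l generalizing u with
  | nil => exact ⟨u, h, [], rfl, rfl⟩
  | cons e l ih =>
    obtain ⟨e', he', rfl⟩ := (hp u).surjOn h.1
    have h2 := h.2
    rw [p.tgt_onE] at h2
    obtain ⟨w', hw, l', hl', rfl⟩ := ih h2
    exact ⟨w', hw, e' :: l', ⟨he', hl'⟩, rfl⟩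

theorem lifts_unique (hp : p.HasUniqueLifts) {u w₁ w₂ : V'} {l : List D}
    (h₁ : p.Lifts u l w₁) (h₂ : p.Lifts u l w₂) :
    w₁ = w₂ := by
  obtain ⟨l₁, h₁, rfl⟩ := h₁
  obtain ⟨l₂, h₂, h⟩ := h₂
  induction l₁ generalizing u l₂ with
  | nil =>
    obtain rfl : l₂ = [] := by simpa using h
    exact Eq.trans (Eq.symm h₁) h₂
  | cons e l₁ ih =>
    obtain ⟨e₂, l₂, rfl, he, hl⟩ := List.map_eq_cons_iff.1 h
    obtain rfl := (hp u).injOn h₁.1 h₂.1 he.symm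
    exact ih h₁.2 _ h₂.2 hl

/-- The endpoint of the lift of a loop does not change under an elementary homotopy, since the lift
of `(e, inv e)` backtracks. -/
theorem lifts_iff_of_step (hp : p.HasUniqueLifts) {v w : V'} {a b : Γ.Loop (p.onV v)}
    (h : Γ.Step a b) :
    p.Lifts v a.1 w ↔ p.Lifts v b.1 w := by
  obtain ⟨l, r, e, ha, hb⟩ := h
  have hpath := b.2
  rw [hb] at hpath
  obtain ⟨m, hm, -⟩ := MultiDigraph.isPath_append_iff.1 hpath
  obtain ⟨m₁, h₁, h₂⟩ := MultiDigraph.isPath_append_iff.1 hm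
  obtain ⟨n, rfl, hn⟩ := hp.exists_lift h₁
  obtain ⟨e', he', rfl⟩ := (hp n).surjOn h₂.1
  have hback : p.Lifts n [p.onE e', Γ.inv (p.onE e')] n :=
    ⟨[e', Γ'.inv e'], ⟨he', Γ'.src_inv e', (Γ'.tgt_inv e').trans he'⟩, by simp [p.onE_inv]⟩
  rw [ha, hb, lifts_append_iff, lifts_append_iff]
  constructor
  · rintro ⟨n', hn', hr⟩
    obtain rfl := hp.lifts_unique hn hn'
    exact ⟨n, lifts_append_iff.2 ⟨n, hn, hback⟩, hr⟩
  · rintro ⟨n', hn', hr⟩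
    obtain rfl := hp.lifts_unique (lifts_append_iff.2 ⟨n, hn, hback⟩) hn'
    exact ⟨n, hn, hr⟩

/-- Loops whose class lies in the image of `p_*` lift to loops. -/
theorem lifts_of_mem_range (hp : p.HasUniqueLifts) {v : V'} {a : Γ.Loop (p.onV v)}
    (h : FundGroup.mk Γ (p.onV v) a ∈ (p.mapFundGroup v).range) : p.Lifts v a.1 v := by
  obtain ⟨c, hc⟩ := h
  induction c using Quotient.inductionOn' with
  | h c =>
    have hrel : Relation.EqvGen Γ.Step (⟨c.1.map p.onE, p.isPath_map c.2⟩ : Γ.Loop (p.onV v)) a :=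
      Quotient.exact hc
    have key : ∀ a b : Γ.Loop (p.onV v), Relation.EqvGen Γ.Step a b →
        (p.Lifts v a.1 v ↔ p.Lifts v b.1 v) := by
      intro a b hab
      induction hab with
      | rel _ _ h => exact hp.lifts_iff_of_step h
      | refl _ => exact Iff.rfl
      | symm _ _ _ ih => exact ih.symm
      | trans _ _ _ _ _ ih₁ ih₂ => exact ih₁.trans ih₂
    exact (key _ _ hrel).1 ⟨c.1, c.2, rfl⟩

end HasUniqueLifts

/-! ### Vertices of a normal covering as pairs of a vertex and a Galois element -/

section Sheet

variable {v' : V'} (S : Γ.PathSystem (p.onV v')) (hconn : Γ'.IsConnected)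

/-- The sheet of a vertex `u` of the covering: the class in the Galois group of the projection of
a path from the base point to `u`, closed up in the base graph. -/
noncomputable def sheet (u : V') : Γ.FundGroup (p.onV v') ⧸ (p.mapFundGroup v').range :=
  QuotientGroup.mk (S.cls (p.isPath_map (hconn v' u).choose_spec))

/-- Normality makes the sheet independent of the path: the classes of two paths to `u` differ by
the class of a projected loop, up to the order of the factors. -/
theorem sheet_eq [hN : (p.mapFundGroup v').range.Normal] {u : V'} {l : List D'}
    (h : Γ'.IsPath v' l u) : sheet S hconn u = QuotientGroup.mk (S.cls (p.isPath_map h)) := by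
  refine QuotientGroup.eq.2 (hN.mem_comm ?_)
  set q := (hconn v' u).choose
  have hq : Γ'.IsPath v' q u := (hconn v' u).choose_spec
  rw [← S.cls_rev, ← S.cls_append, S.cls_loop]
  refine ⟨FundGroup.mk Γ' v' ⟨l ++ Γ'.rev q, h.append (Γ'.isPath_reverse hq)⟩, ?_⟩
  refine congrArg (FundGroup.mk Γ _) (Subtype.ext ?_)
  change (l ++ Γ'.rev q).map p.onE = l.map p.onE ++ Γ.rev (q.map p.onE)
  rw [List.map_append, p.map_rev]

theorem sheet_tgt [(p.mapFundGroup v').range.Normal] (e : D') :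
    sheet S hconn (Γ'.tgt e) =
      sheet S hconn (Γ'.src e) * QuotientGroup.mk (S.edge (p.onE e)) := by
  obtain ⟨l, hl⟩ := hconn v' (Γ'.src e)
  have he : Γ'.IsPath (Γ'.src e) [e] (Γ'.tgt e) := ⟨rfl, rfl⟩
  rw [sheet_eq S hconn hl, sheet_eq S hconn (hl.append he), ← QuotientGroup.mk_mul]
  congr 1
  have h1 : S.cls (p.isPath_map he) = S.edge (p.onE e) :=
    S.cls_congr _ _ (p.src_onE e).symm rfl
  rw [← h1, ← S.cls_append]
  exact S.cls_congr _ _ rfl List.map_append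

theorem sheet_injective [hN : (p.mapFundGroup v').range.Normal] (hp : p.HasUniqueLifts) {u w : V'}
    (huw : p.onV u = p.onV w) (h : sheet S hconn u = sheet S hconn w) : u = w := by
  obtain ⟨l, hl⟩ := hconn v' u
  obtain ⟨m, hm⟩ := hconn v' w
  have hm' : Γ.IsPath (p.onV v') (m.map p.onE) (p.onV u) := huw ▸ p.isPath_map hm
  have hcls : S.cls (p.isPath_map hm) = S.cls hm' := S.cls_congr _ _ rfl rfl
  rw [sheet_eq S hconn hl, sheet_eq S hconn hm, eq_comm, QuotientGroup.eq, hcls] at h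
  have h := hN.mem_comm h
  rw [← S.cls_rev, ← S.cls_append, S.cls_loop] at h
  -- The loop running along `l` and back along `m` lifts to a loop through `u`, hence the lift of
  -- `m` ends at `u`.
  obtain ⟨n, h1, h2⟩ := lifts_append_iff.1 (hp.lifts_of_mem_range h)
  obtain rfl := hp.lifts_unique h1 ⟨l, hl, rfl⟩
  have h3 : p.Lifts v' (Γ.rev (Γ.rev (m.map p.onE))) n := h2.rev
  rw [rev_rev] at h3
  exact hp.lifts_unique h3 ⟨m, hm, rfl⟩

theorem exists_sheet_eq [(p.mapFundGroup v').range.Normal] (hp : p.HasUniqueLifts)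
    (v : V) (g : Γ.FundGroup (p.onV v') ⧸ (p.mapFundGroup v').range) :
    ∃ u, p.onV u = v ∧ sheet S hconn u = g := by
  induction g using QuotientGroup.induction_on with
  | H g =>
    induction g using Quotient.inductionOn' with
    | h a =>
      -- The vertex sought is the end of the lift of `a` followed by the chosen path to `v`.
      obtain ⟨u, rfl, l, hl, hla⟩ := hp.exists_lift (MultiDigraph.IsPath.append a.2 (S.isPath v))
      refine ⟨u, rfl, ?_⟩
      rw [sheet_eq S hconn hl]
      congr 1
      have h0 : S.cls (S.isPath (p.onV u)) = 1 := by
        rw [← S.cls_nil (p.onV u)]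
        exact Γ.loopCls_congr _ _ (by simp [S.path_base])
      rw [S.cls_congr _ (MultiDigraph.IsPath.append a.2 (S.isPath _)) rfl hla,
        S.cls_append a.2 (S.isPath _), h0, mul_one, S.cls_loop a.2]
      rfl

end Sheet

end Hom

end SerreGraph

/-! ### Connections and their holonomy -/

namespace SerreGraph

variable {V D : Type*} {Γ : SerreGraph V D} {W : Type*} [AddCommGroup W] [Module ℂ W]

namespace Connection

/-- The parallel transport `φ e₁ ∘ ⋯ ∘ φ eₙ` along a path, from the fibre over its target to the
fibre over its source. -/
def holonomy (Φ : Γ.Connection W) (l : List D) : W ≃ₗ[ℂ] W := (l.map Φ.φ).prod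

theorem holonomy_append (Φ : Γ.Connection W) (l m : List D) :
    Φ.holonomy (l ++ m) = Φ.holonomy l * Φ.holonomy m := by
  simp [holonomy]

theorem holonomy_rev (Φ : Γ.Connection W) (l : List D) :
    Φ.holonomy (Γ.rev l) = (Φ.holonomy l)⁻¹ := by
  simp [holonomy, rev, List.prod_inv_reverse, Function.comp_def, Φ.φ_inv]

theorem monodromy_loopCls (Φ : Γ.Connection W) {v : V} {l : List D} (h : Γ.IsPath v l v)
    (w : W) :
    Φ.monodromy v (Γ.loopCls l h) w = Φ.holonomy l w := rfl

end Connection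

namespace PathSystem

variable {v₀ : V} (S : Γ.PathSystem v₀)

/-- Parallel transport along the chosen paths trivializes the fibres, and turns the connection into
its monodromy along the classes of the edges. -/
theorem holonomy_path_apply (Φ : Γ.Connection W) (e : D) (w : W) :
    Φ.holonomy (S.path (Γ.src e)) (Φ.φ e w) =
      Φ.monodromy v₀ (S.edge e) (Φ.holonomy (S.path (Γ.tgt e)) w) := by
  rw [edge, cls, Φ.monodromy_loopCls, Φ.holonomy_append, Φ.holonomy_append, Φ.holonomy_rev]
  simp [Connection.holonomy]

/-- Every representation of the fundamental group is the monodromy of a connection: the one that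
acts along an edge through the class of that edge. -/
theorem exists_connection (S : Γ.PathSystem v₀) (τ : Representation ℂ (Γ.FundGroup v₀) W) :
    ∃ Φ : Γ.Connection W, Φ.monodromy v₀ = τ := by
  let τ' : Γ.FundGroup v₀ →* (W ≃ₗ[ℂ] W) :=
    (LinearMap.GeneralLinearGroup.generalLinearEquiv ℂ W).toMonoidHom.comp τ.toHomUnits
  let Φ : Γ.Connection W :=
    ⟨fun e => τ' (S.edge e), fun e => by rw [S.edge_inv, map_inv]⟩
  have hΦ : ∀ (l : List D) (v w : V) (h : Γ.IsPath v l w), Φ.holonomy l = τ' (S.cls h) := by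
    intro l
    induction l with
    | nil =>
      rintro v _ rfl
      rw [S.cls_nil, map_one]
      rfl
    | cons e l ih =>
      intro v w h
      rw [S.cls_cons, map_mul, ← ih _ _ h.2]
      simp [Connection.holonomy, Φ]
  refine ⟨Φ, MonoidHom.ext fun g => ?_⟩
  induction g using Quotient.inductionOn' with
  | h a =>
    refine LinearMap.ext fun w => ?_
    change Φ.holonomy a.1 w = τ (Γ.loopCls a.1 a.2) w
    rw [hΦ _ _ _ a.2, S.cls_loop]
    rfl

end PathSystem

end SerreGraph

/-! ### The adjacency operator of a normal covering -/

namespace MultiDigraph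

variable {V D V' D' : Type*} {Γ : MultiDigraph V D} {Γ' : MultiDigraph V' D'} {p : Hom Γ' Γ}

theorem Hom.IsCovering.hasUniqueLifts (hp : p.IsCovering) : p.assocGraph.HasUniqueLifts := by
  intro v
  refine ⟨?_, ?_, ?_⟩
  · rintro (e | e) he
    · exact (hp.bijOn_out v).mapsTo he
    · exact (hp.bijOn_in v).mapsTo he
  · rintro (e | e) he (e' | e') he' h
    · exact congrArg Sum.inl ((hp.bijOn_out v).injOn he he' (Sum.inl.inj h))
    · cases h
    · cases h
    · exact congrArg Sum.inr ((hp.bijOn_in v).injOn he he' (Sum.inr.inj h))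
  · rintro (e | e) he
    · obtain ⟨e', he', rfl⟩ := (hp.bijOn_out v).surjOn he
      exact ⟨Sum.inl e', he', rfl⟩
    · obtain ⟨e', he', rfl⟩ := (hp.bijOn_in v).surjOn he
      exact ⟨Sum.inr e', he', rfl⟩

theorem Hom.IsCovering.nonempty_pathSystem (hp : p.IsCovering)
    (hconn : Γ'.assocGraph.IsConnected) (v' : V') :
    Nonempty (Γ.assocGraph.PathSystem (p.onV v')) := by
  refine SerreGraph.nonempty_pathSystem fun v => ?_
  obtain ⟨u, rfl⟩ := hp.surjective v
  obtain ⟨l, hl⟩ := hconn v' u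
  exact ⟨_, p.assocGraph.isPath_map hl⟩

/-- The adjacency operator of the covering, as a sum over the edges downstairs: the outgoing edges
at a vertex correspond to those at its projection. -/
theorem Hom.IsCovering.adjOp_apply (hp : p.IsCovering) (hΓ : Γ.IsLocallyFinite) (x : D → ℂ)
    (f : V' → ℂ) (F : D → ℂ) (u : V') (hF : ∀ e, Γ'.src e = u → f (Γ'.tgt e) = F (p.onE e)) :
    Γ'.adjOp (hp.isLocallyFinite hΓ) (x ∘ p.onE) f u =
      ∑ e ∈ (hΓ.out (p.onV u)).toFinset, x e * F e := by
  refine Finset.sum_bij (fun e _ => p.onE e) ?_ ?_ ?_ ?_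
  · intro e he
    exact (Set.Finite.mem_toFinset _).2
      ((hp.bijOn_out u).mapsTo ((Set.Finite.mem_toFinset _).1 he))
  · intro e he e' he' h
    exact (hp.bijOn_out u).injOn ((Set.Finite.mem_toFinset _).1 he)
      ((Set.Finite.mem_toFinset _).1 he') h
  · intro e he
    obtain ⟨e', he', h⟩ := (hp.bijOn_out u).surjOn ((Set.Finite.mem_toFinset _).1 he)
    exact ⟨e', (Set.Finite.mem_toFinset _).2 he', h⟩
  · intro e he
    have he' : e ∈ Γ'.outEdges u := (Set.Finite.mem_toFinset _).1 he
    rw [hF e he']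
    rfl

variable {v' : V'} (S : Γ.assocGraph.PathSystem (p.onV v'))

/-- The vertices of a connected normal covering are the pairs of a vertex downstairs and an element
of the Galois group; crossing an edge `e` multiplies the latter by the class of `p e`. -/
theorem Hom.IsCovering.exists_vertexEquiv (hp : p.IsCovering)
    (hconn : Γ'.assocGraph.IsConnected) [(p.imageFundGroup v').Normal] :
    ∃ E : V' ≃ V × p.GaloisGroup v', (∀ u, (E u).1 = p.onV u) ∧
      ∀ e, (E (Γ'.tgt e)).2 =
        (E (Γ'.src e)).2 * QuotientGroup.mk (S.edge (Sum.inl (p.onE e))) := by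
  have hN : (p.assocGraph.mapFundGroup v').range.Normal := ‹_›
  refine ⟨Equiv.ofBijective
    (fun u => (p.onV u, SerreGraph.Hom.sheet (p := p.assocGraph) S hconn u)) ⟨?_, ?_⟩,
    fun _ => rfl, fun e => SerreGraph.Hom.sheet_tgt (p := p.assocGraph) S hconn (Sum.inl e)⟩
  · intro u w h
    exact SerreGraph.Hom.sheet_injective (p := p.assocGraph) S hconn hp.hasUniqueLifts
      (congrArg Prod.fst h) (congrArg Prod.snd h)
  · rintro ⟨v, g⟩
    obtain ⟨u, h1, h2⟩ :=
      SerreGraph.Hom.exists_sheet_eq (p := p.assocGraph) S hconn hp.hasUniqueLifts v g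
    exact ⟨u, Prod.ext h1 h2⟩

/-- If the functions on the Galois group under right translation decompose, by `Θ`, into copies of
representations `ρ i`, then the adjacency operator of the covering decomposes into copies
of the adjacency operators twisted by connections with monodromies `ρ i`. -/
theorem Hom.IsCovering.exists_linearEquiv_pi (hp : p.IsCovering)
    (hconn : Γ'.assocGraph.IsConnected) [(p.imageFundGroup v').Normal] (hΓ : Γ.IsLocallyFinite)
    (x : D → ℂ) {ι : Type*} {κ : ι → Type*} {W : ι → Type*} [∀ i, AddCommGroup (W i)]
    [∀ i, Module ℂ (W i)] {ρ : ∀ i, Representation ℂ (p.GaloisGroup v') (W i)}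
    (Θ : (p.GaloisGroup v' → ℂ) ≃ₗ[ℂ] (∀ i, κ i → W i))
    (hΘ : ∀ (h : p.GaloisGroup v') (F : p.GaloisGroup v' → ℂ) i j,
      Θ (fun g => F (g * h)) i j = ρ i h (Θ F i j))
    (Φ : ∀ i, Γ.assocGraph.Connection (W i))
    (hΦ : ∀ i, (Φ i).monodromy (p.onV v') =
      (ρ i).comp (QuotientGroup.mk' (p.imageFundGroup v'))) :
    ∃ ψ : (V' → ℂ) ≃ₗ[ℂ] (∀ i, κ i → V → W i), ∀ f i j,
      ψ (Γ'.adjOp (hp.isLocallyFinite hΓ) (x ∘ p.onE) f) i j =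
        Γ.twistedAdjOp hΓ x (Φ i) (ψ f i j) := by
  obtain ⟨S⟩ := hp.nonempty_pathSystem hconn v'
  obtain ⟨E, hE₁, hE₂⟩ := hp.exists_vertexEquiv S hconn
  -- Read a function on `V'` as a function on `V` with values in the functions on the Galois group,
  -- decompose those values by `Θ`, and undo the trivialization of the fibres by parallel transport.
  let swap : (V → ∀ i, κ i → W i) ≃ₗ[ℂ] (∀ i, κ i → V → W i) :=
    { toFun := fun f i j v => f v i j
      invFun := fun f v i j => f i j v
      map_add' := fun _ _ => rfl
      map_smul' := fun _ _ => rfl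
      left_inv := fun _ => rfl
      right_inv := fun _ => rfl }
  let ψ : (V' → ℂ) ≃ₗ[ℂ] (∀ i, κ i → V → W i) :=
    (LinearEquiv.funCongrLeft ℂ ℂ E.symm).trans <|
    (LinearEquiv.curry ℂ ℂ V (p.GaloisGroup v')).trans <|
    (LinearEquiv.piCongrRight fun _ => Θ).trans <| swap.trans <|
    LinearEquiv.piCongrRight fun i => LinearEquiv.piCongrRight fun _ =>
      LinearEquiv.piCongrRight fun v => ((Φ i).holonomy (S.path v)).symm
  have hψ (f i j v) : ψ f i j v =
    ((Φ i).holonomy (S.path v)).symm (Θ (fun g => f (E.symm (v, g))) i j) := rfl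
  refine ⟨ψ, fun f i j => funext fun v => ?_⟩
  have hadj : (fun g => Γ'.adjOp (hp.isLocallyFinite hΓ) (x ∘ p.onE) f (E.symm (v, g))) =
      ∑ e ∈ (hΓ.out v).toFinset, x e • fun g : p.GaloisGroup v' =>
        f (E.symm (Γ.tgt e, g * QuotientGroup.mk (S.edge (Sum.inl e)))) := by
    funext g
    have hv : p.onV (E.symm (v, g)) = v := by rw [← hE₁, E.apply_symm_apply]
    rw [hp.adjOp_apply hΓ x f
      (fun e => f (E.symm (Γ.tgt e, g * QuotientGroup.mk (S.edge (Sum.inl e))))), hv]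
    · simp
    · intro e he
      congr 1
      rw [E.eq_symm_apply]
      refine Prod.ext ?_ ?_
      · rw [hE₁, p.tgt_onE]
      · rw [hE₂, he, E.apply_symm_apply]
  rw [hψ, hadj, map_sum]
  change _ = ∑ e ∈ (hΓ.out v).toFinset, x e • (Φ i).φ (Sum.inl e) (ψ f i j (Γ.tgt e))
  rw [Finset.sum_apply, Finset.sum_apply, map_sum]
  refine Finset.sum_congr rfl fun e he => ?_
  have hev : e ∈ Γ.outEdges v := (Set.Finite.mem_toFinset _).1 he
  obtain rfl : Γ.src e = v := hev
  rw [map_smul, Pi.smul_apply, Pi.smul_apply, map_smul, hψ]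
  congr 1
  rw [LinearEquiv.symm_apply_eq]
  refine Eq.trans ?_ (S.holonomy_path_apply (Φ i) (Sum.inl e) _).symm
  rw [hΦ]
  refine (hΘ _ (fun g => f (E.symm (Γ.tgt e, g))) i j).trans ?_
  change _ = ρ i _ ((Φ i).holonomy (S.path (Γ.tgt e)) _)
  rw [LinearEquiv.apply_symm_apply]
  rfl

/-- The Galois group of a covering of finite degree is finite: it is in bijection with the fibre of
the base point. -/
theorem Hom.IsCovering.finite_galoisGroup (hp : p.IsCovering) (hfin : p.HasFiniteDegree)
    (hconn : Γ'.assocGraph.IsConnected) [(p.imageFundGroup v').Normal] :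
    Finite (p.GaloisGroup v') := by
  obtain ⟨S⟩ := hp.nonempty_pathSystem hconn v'
  obtain ⟨E, hE₁, -⟩ := hp.exists_vertexEquiv S hconn
  have := (hfin (p.onV v')).to_subtype
  refine Finite.of_injective
    (fun g => (⟨E.symm (p.onV v', g), ?_⟩ : p.onV ⁻¹' {p.onV v'})) fun g h hgh => ?_
  · change p.onV _ = _
    rw [← hE₁ (E.symm _), E.apply_symm_apply]
  · exact congrArg Prod.snd (E.symm.injective (congrArg Subtype.val hgh))

end MultiDigraph

/-! ### Decomposition of the adjacency operator -/

theorem mainTheorem4 {V D V' D' : Type*}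
    (Γ : MultiDigraph V D) (Γ' : MultiDigraph V' D')
    (hΓ : Γ.IsLocallyFinite) (x : D → ℂ)
    (p : MultiDigraph.Hom Γ' Γ) (hp : p.IsCovering) (hfin : p.HasFiniteDegree)
    (hconn : Γ'.assocGraph.IsConnected)
    (v' : V') [hnormal : (p.imageFundGroup v').Normal]
    {ι : Type*} {W : ι → Type*} [∀ i, AddCommGroup (W i)] [∀ i, Module ℂ (W i)]
    (ρ : ∀ i, Representation ℂ (p.GaloisGroup v') (W i)) (hρ : IsIrrepList ρ) :
    (∀ i, ∃ Φ : Γ.assocGraph.Connection (W i),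
      Φ.monodromy (p.onV v') = (ρ i).comp (QuotientGroup.mk' (p.imageFundGroup v'))) ∧
    ∀ Φ : ∀ i, Γ.assocGraph.Connection (W i),
      (∀ i, (Φ i).monodromy (p.onV v') =
        (ρ i).comp (QuotientGroup.mk' (p.imageFundGroup v'))) →
      ∃ ψ : (V' → ℂ) ≃ₗ[ℂ] ⨁ i, ⨁ _ : Fin (Module.finrank ℂ (W i)), (V → W i),
        ψ.conj (Γ'.adjOp (hp.isLocallyFinite hΓ) (x ∘ p.onE)) =
          DirectSum.lmap fun i => DirectSum.lmap fun _ =>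
            Γ.twistedAdjOp hΓ x (Φ i) := by
  refine ⟨fun i => (hp.nonempty_pathSystem hconn v').some.exists_connection _, fun Φ hΦ => ?_⟩
  have := hp.finite_galoisGroup hfin hconn (v' := v')
  obtain ⟨hι, Θ, hΘ⟩ := hρ.exists_regular_linearEquiv
  have := Fintype.ofFinite ι
  obtain ⟨ψ, hψ⟩ := hp.exists_linearEquiv_pi hconn hΓ x Θ hΘ Φ hΦ
  let B : (⨁ i, ⨁ _ : Fin (Module.finrank ℂ (W i)), (V → W i)) ≃ₗ[ℂ]
      (∀ i, Fin (Module.finrank ℂ (W i)) → V → W i) :=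
    (DirectSum.linearEquivFunOnFintype ℂ ι _).trans
      (LinearEquiv.piCongrRight fun i => DirectSum.linearEquivFunOnFintype ℂ _ _)
  have hB (y i j) : B y i j = y i j := rfl
  have hψB (f) : B ((ψ.trans B.symm) f) = ψ f := B.apply_symm_apply _
  refine ⟨ψ.trans B.symm, LinearMap.ext fun y => B.injective (funext fun i => funext fun j => ?_)⟩
  rw [hB (DirectSum.lmap _ _), DirectSum.lmap_apply, DirectSum.lmap_apply, ← hB,
    LinearEquiv.conj_apply_apply, hψB, hψ]
  exact congrArg (fun z => Γ.twistedAdjOp hΓ x (Φ i) (z i j)) (ψ.apply_symm_apply (B y))
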